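/- Let $S\ge 2$ and consider two optical paths (signal and probe) with $S$ bosonic modes each, $a_1,\dots,a_S$ and $b_1,\dots,b_S$. A beam splitter acts identically on all mode pairs by $a_i\mapsto \eta a_i+\zeta b_i$, $b_i\mapsto \zeta a_i-\eta b_i$, where $\eta,\zeta$ are nonzero real numbers with $\eta^2+\zeta^2=1$. The probe path is prepared in the coherent state with amplitude $\gamma\in\mathbb C$ in mode $b_1$ and vacuum in $b_2,\dots,b_S$. A photon counter at the first output path counts the total number of photons in all $S$ modes of that path; let $p_k(\gamma;\rho)$ be the probability that it observes $k$ photons when the signal path is in the state $\rho$. A (two-mode) twirled state is a density operator of the form $\tilde\rho_2=\sum_{i\ge 0}\chi_i\otimes|i\rangle\langle i|$ on modes $a_1,a_2$, where $\chi_i$ acts on mode $a_1$ and $|i\rangle$ is the $i$-photon Fock state of mode $a_2$, the modes $a_3,\dots,a_S$ being in vacuum. Let $N\ge 0$ be an integer, let $\mathcal P_N$ be the complex vector space of functions on $\mathbb C$ spanned by the monomials $\gamma\mapsto\gamma^k(\gamma^*)^l$ with $0\le k,l\le N$, and let $\Gamma\subset\mathbb C$ be a finite set such that every $p\in\mathcal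 P_N$ that vanishes on $\Gamma$ is zero. Then a twirled state with at most $N$ photons is uniquely determined by the statistics of the single counter at the probe amplitudes in $\Gamma$: if $\rho,\sigma$ are twirled states supported on the subspace with total photon number at most $N$, and $p_k(\gamma;\rho)=p_k(\gamma;\sigma)$ for all $\gamma\in\Gamma$ and all $k\ge 0$, then $\rho=\sigma$. -/

import Mathlib

noncomputable section

open scoped ComplexOrder in
/-- A density operator on `ℓ²(ι)` in the standard basis: an `ι × ι` complex matrix that is positive
semidefinite and has trace one. -/
structure DensityMatrix (ι : Type*) where
  mat : Matrix ι ι ℂ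
  posSemidef : mat.PosSemidef
  trace_one : HasSum (fun i => mat i i) 1

/-- Occupation numbers of the `S = r + 2` modes of one path.  They index the Fock basis of
that path.  Mode `0` is the mode matched to the local oscillator. -/
abbrev Occ (r : ℕ) := Fin (r + 2) → ℕ

/-- A (two-mode) twirled state: `ρ = (∑ᵢ χᵢ ⊗ |i⟩⟨i|) ⊗ |vac⟩⟨vac|`, with `χᵢ` acting on mode `0`,
the Fock states `|i⟩` in mode `1`, and vacuum in all further modes. -/
def IsTwirled {r : ℕ} (ρ : DensityMatrix (Occ r)) : Prop :=
  ∃ χ : ℕ → Matrix ℕ ℕ ℂ, ∀ n m : Occ r,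
    ((n 1 = m 1 ∧ ∀ i : Fin (r + 2), 2 ≤ (i : ℕ) → n i = 0 ∧ m i = 0) →
      ρ.mat n m = χ (n 1) (n 0) (m 0)) ∧
    (¬ (n 1 = m 1 ∧ ∀ i : Fin (r + 2), 2 ≤ (i : ℕ) → n i = 0 ∧ m i = 0) →
      ρ.mat n m = 0)

/-- The state is supported on the subspace with at most `N` photons in total. -/
def HasMaxPhotons {r : ℕ} (ρ : DensityMatrix (Occ r)) (N : ℕ) : Prop :=
  ∀ n m : Occ r, (N < ∑ i, n i ∨ N < ∑ i, m i) → ρ.mat n m = 0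

/-- The Fock amplitude `⟨l|γ⟩` of the one-mode coherent state of amplitude `γ`. -/
def coherentAmp (γ : ℂ) (l : ℕ) : ℂ :=
  Complex.exp (-((‖γ‖ ^ 2 / 2 : ℝ) : ℂ)) * γ ^ l / ((Real.sqrt (l.factorial : ℝ) : ℝ) : ℂ)

/-- The Fock amplitude of the probe state: the coherent state `|γ e₁⟩`, that is, `|γ⟩` in
mode `0` of the probe path and vacuum (the coherent state of amplitude `0`) in the other modes. -/
def probeAmp {r : ℕ} (γ : ℂ) (l : Occ r) : ℂ :=
  ∏ i, coherentAmp (if i = 0 then γ else 0) (l i)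

open MvPolynomial in
/-- The matrix element `⟨p, q| U |n, l⟩` of the unitary `U` of a beam splitter acting on one pair of
modes, `a` of the signal path and `b` of the probe path, by `a ↦ η a + ζ b`, `b ↦ ζ a - η b`.
Since `|n, l⟩ = (a†)ⁿ (b†)ˡ |0⟩ / √(n! l!)`, one has
`U |n, l⟩ = (η a† + ζ b†)ⁿ (ζ a† - η b†)ˡ |0⟩ / √(n! l!)`; the variables `X 0`, `X 1` stand for
`a†`, `b†`. -/
def bsAmpPair (η ζ : ℝ) (n l p q : ℕ) : ℂ :=
  ((Real.sqrt ((p.factorial * q.factorial : ℝ) / (n.factorial * l.factorial : ℝ)) : ℝ) : ℂ) *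
    MvPolynomial.coeff (Finsupp.single (0 : Fin 2) p + Finsupp.single (1 : Fin 2) q)
      ((C (η : ℂ) * X 0 + C (ζ : ℂ) * X 1) ^ n * (C (ζ : ℂ) * X 0 - C (η : ℂ) * X 1) ^ l)

/-- The matrix element `⟨p, q| U |n, l⟩` of the beam splitter that acts identically on all mode
pairs (trivial partition). -/
def bsAmp {r : ℕ} (η ζ : ℝ) (n l p q : Occ r) : ℂ :=
  ∏ i, bsAmpPair η ζ (n i) (l i) (p i) (q i)

/-- The probability `⟨p, q| U (ρ ⊗ |γ e₁⟩⟨γ e₁|) U† |p, q⟩` of the occupation numbers `p`, `q` at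
the two outputs of the beam splitter.  Since `U` conserves the photon number of each mode pair, only
the inputs `|n, l⟩` with `n + l = p + q` contribute. -/
def outputProb {r : ℕ} (η ζ : ℝ) (γ : ℂ) (ρ : DensityMatrix (Occ r)) (p q : Occ r) : ℝ :=
  (∑ n ∈ Finset.Iic (p + q), ∑ m ∈ Finset.Iic (p + q),
    bsAmp η ζ n (p + q - n) p q * probeAmp γ (p + q - n) * ρ.mat n m *
      star (bsAmp η ζ m (p + q - m) p q * probeAmp γ (p + q - m))).re

/-- The probability that the counter at the first output, which counts the photons of all modes
of that path without resolving the modes, observes `k` photons when the probe amplitude is `γ`. -/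
def counterProb {r : ℕ} (η ζ : ℝ) (γ : ℂ) (ρ : DensityMatrix (Occ r)) (k : ℕ) : ℝ :=
  ∑' x : Occ r × Occ r, if ∑ i, x.1 i = k then outputProb η ζ γ ρ x.1 x.2 else 0

/-- The space spanned by the functions `γ ↦ γᵏ (γ*)ˡ` with `k, l ≤ N`. -/
def polySpace (N : ℕ) : Submodule ℂ (ℂ → ℂ) :=
  Submodule.span ℂ {f | ∃ k l : ℕ, k ≤ N ∧ l ≤ N ∧ f = fun γ => γ ^ k * (star γ) ^ l}

/-- `Γ` is unisolvent for `polySpace N`: the only element vanishing on `Γ` is zero. -/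
def Unisolvent (N : ℕ) (Γ : Finset ℂ) : Prop :=
  ∀ p ∈ polySpace N, (∀ γ ∈ Γ, p γ = 0) → p = 0

end

/-! In the Bargmann picture a mode pair with input `|n⟩` and coherent probe `γ` becomes, up to
normalisation, `(η x + ζ y)ⁿ exp (γ (ζ x - η y))`. Since multiplication by a variable is adjoint to
differentiation, tracing out `y` and marking the photons of the first output by `X` gives overlaps
satisfying a Hermite-type recursion (`mk_overlapCoeff`). They equal a common invertible series times
`H_ab(Y, γ* v, γ v)`, with `Y = η² X + ζ²` and `v = η ζ (X - 1)`; for vacuum probe only `i! Yⁱ`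
remains on the diagonal.

Photon numbers add over modes, so generating functions multiply. The common factor cancels, and
equal statistics for `ρ` and `σ` become `∑ Dᵢₐᵦ Yⁱ H_ab(Y, γ* v, γ v) = 0` for `γ ∈ Γ`, where `D` is
the difference of matrix elements up to nonzero weights.

At each numerical value of `X` this is an element of `polySpace N` in `γ`, so unisolvence extends it
to all `γ`. For `X ≠ 1` one has `v ≠ 0`, and `γ* v`, `γ v` may be replaced by independent variables
`u`, `w`; infinitely many values of `Y` then make `Y` independent too. As `H_ab(0, u, w) = uᵃ wᵇ`,
comparing powers of `Y` from the lowest upwards kills every `D`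
(`coeff_eq_zero_of_sum_hermiteOverlap_eq_zero`). -/

/-! ### Beam splitter amplitudes as Taylor coefficients -/

/-- The Taylor coefficient of `xᵖ y^q` in `(η x + ζ y)ⁿ exp (γ (ζ x - η y))`. -/
noncomputable def bargmannCoeff (η ζ : ℝ) (γ : ℂ) : ℕ → ℕ → ℕ → ℂ
  | 0, p, q => (γ * ζ) ^ p / p.factorial * ((-(γ * η)) ^ q / q.factorial)
  | n + 1, p, q =>
    η * (if p = 0 then 0 else bargmannCoeff η ζ γ n (p - 1) q) +
      ζ * (if q = 0 then 0 else bargmannCoeff η ζ γ n p (q - 1))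

open MvPolynomial in
theorem coeff_linear_mul (α β : ℂ) (P : MvPolynomial (Fin 2) ℂ) (p q : ℕ) :
    coeff (Finsupp.single 0 p + Finsupp.single 1 q) ((C α * X 0 + C β * X 1) * P) =
      α * (if p = 0 then 0 else coeff (Finsupp.single 0 (p - 1) + Finsupp.single 1 q) P) +
      β * (if q = 0 then 0 else coeff (Finsupp.single 0 p + Finsupp.single 1 (q - 1)) P) := by
  rw [add_mul, coeff_add, mul_assoc, mul_assoc, coeff_C_mul, coeff_C_mul, coeff_X_mul',
    coeff_X_mul']
  congr 2
  · rcases p with _ | p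
    · simp
    · rw [if_pos (by simp), if_neg (by simp)]
      congr 1
      ext j
      fin_cases j <;> simp
  · rcases q with _ | q
    · simp
    · rw [if_pos (by simp), if_neg (by simp)]
      congr 1
      ext j
      fin_cases j <;> simp

open MvPolynomial in
theorem coeff_linear_pow (α β : ℂ) (l p q : ℕ) (h : p + q = l) :
    coeff (Finsupp.single 0 p + Finsupp.single 1 q)
      ((C α * X 0 + C β * X 1 : MvPolynomial (Fin 2) ℂ) ^ l) * (p.factorial * q.factorial) =
      l.factorial * α ^ p * β ^ q := by
  induction l generalizing p q with
  | zero =>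
    obtain ⟨rfl, rfl⟩ : p = 0 ∧ q = 0 := by omega
    simp
  | succ l ih =>
    rw [pow_succ', coeff_linear_mul]
    rcases p with _ | p <;> rcases q with _ | q
    · omega
    · have := ih 0 q (by omega)
      obtain rfl : q = l := by omega
      simp only [Nat.factorial_succ, if_true, Nat.add_sub_cancel, Nat.succ_ne_zero, if_false] at *
      push_cast at *
      linear_combination β * (q + 1) * this
    · have := ih p 0 (by omega)
      obtain rfl : p = l := by omega
      simp only [Nat.factorial_succ, if_true, Nat.add_sub_cancel, Nat.succ_ne_zero, if_false] at *
      push_cast at *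
      linear_combination α * (p + 1) * this
    · have h1 := ih p (q + 1) (by omega)
      have h2 := ih (p + 1) q (by omega)
      obtain rfl : l = p + q + 1 := by omega
      simp only [Nat.factorial_succ (p + q + 1), Nat.factorial_succ p, Nat.factorial_succ q,
        Nat.add_sub_cancel, Nat.succ_ne_zero, if_false] at *
      push_cast at *
      linear_combination α * (p + 1) * h1 + β * (q + 1) * h2

-- Photon conservation: in total degree `p + q` only the term of order `l = p + q - n` of the
-- exponential contributes.
open MvPolynomial in
theorem coeff_mul_pow_div_factorial (η ζ : ℝ) (γ : ℂ) (n l p q : ℕ) (h : n + l = p + q) :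
    coeff (Finsupp.single (0 : Fin 2) p + Finsupp.single (1 : Fin 2) q)
      ((C (η : ℂ) * X 0 + C (ζ : ℂ) * X 1) ^ n * (C (ζ : ℂ) * X 0 - C (η : ℂ) * X 1) ^ l) *
      (γ ^ l / l.factorial) = bargmannCoeff η ζ γ n p q := by
  induction n generalizing p q with
  | zero =>
    have := coeff_linear_pow ζ (-η) l p q (by omega)
    rw [pow_zero, one_mul, sub_eq_add_neg, ← neg_mul, ← map_neg, bargmannCoeff]
    have hp : (p.factorial : ℂ) ≠ 0 := by exact_mod_cast p.factorial_ne_zero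
    have hq : (q.factorial : ℂ) ≠ 0 := by exact_mod_cast q.factorial_ne_zero
    have hl : (l.factorial : ℂ) ≠ 0 := by exact_mod_cast l.factorial_ne_zero
    rw [← mul_right_inj' (mul_ne_zero hp hq), ← mul_assoc, mul_comm (_ * _) (coeff _ _), this]
    obtain rfl : l = p + q := by omega
    field_simp
    rw [neg_pow, neg_pow ((η : ℂ) * γ)]
    ring
  | succ n ih =>
    rw [pow_succ', mul_assoc, coeff_linear_mul, bargmannCoeff]
    rcases p with _ | p <;> rcases q with _ | q
    · omega
    · simp [← ih 0 q (by omega), mul_assoc]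
    · simp [← ih p 0 (by omega), mul_assoc]
    · simp [← ih p (q + 1) (by omega), ← ih (p + 1) q (by omega), mul_assoc, add_mul]

theorem bargmannCoeff_eq_zero (η ζ : ℝ) (γ : ℂ) (n p q : ℕ) (h : p + q < n) :
    bargmannCoeff η ζ γ n p q = 0 := by
  induction n generalizing p q with
  | zero => omega
  | succ n ih =>
    rw [bargmannCoeff]
    split_ifs with h1 h2 h2
    · simp
    · rw [ih _ _ (by omega)]; simp
    · rw [ih _ _ (by omega)]; simp
    · rw [ih _ _ (by omega), ih _ _ (by omega)]; simp

theorem star_bargmannCoeff (η ζ : ℝ) (γ : ℂ) (n p q : ℕ) :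
    star (bargmannCoeff η ζ γ n p q) = bargmannCoeff η ζ (star γ) n p q := by
  induction n generalizing p q with
  | zero => simp [bargmannCoeff]
  | succ n ih =>
    simp only [bargmannCoeff, star_add, star_mul', apply_ite star, ih, star_zero]
    simp

theorem natCast_mul_bargmannCoeff (η ζ : ℝ) (γ : ℂ) (n p q : ℕ) :
    (n : ℂ) * bargmannCoeff η ζ γ n p q =
      n * (η * (if p = 0 then 0 else bargmannCoeff η ζ γ (n - 1) (p - 1) q) +
        ζ * (if q = 0 then 0 else bargmannCoeff η ζ γ (n - 1) p (q - 1))) := by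
  rcases n with _ | n
  · simp
  · rw [bargmannCoeff]; rfl

/-- Coefficient form of `∂ₓ Fₙ = n η Fₙ₋₁ + γ ζ Fₙ`; the truncated `n - 1` is harmless because of
the factor `n`. -/
theorem succ_mul_bargmannCoeff (η ζ : ℝ) (γ : ℂ) (n p q : ℕ) :
    (p + 1) * bargmannCoeff η ζ γ n (p + 1) q =
      n * η * bargmannCoeff η ζ γ (n - 1) p q + γ * ζ * bargmannCoeff η ζ γ n p q := by
  induction n generalizing p q with
  | zero =>
    have hp : (p : ℂ) + 1 ≠ 0 := by exact_mod_cast p.succ_ne_zero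
    simp only [bargmannCoeff, Nat.factorial_succ]
    push_cast
    field_simp
    ring
  | succ n ih =>
    rw [bargmannCoeff, bargmannCoeff, Nat.add_sub_cancel]
    simp only [Nat.succ_ne_zero, if_false, Nat.add_sub_cancel]
    have hk := natCast_mul_bargmannCoeff η ζ γ n p q
    rcases p with _ | p <;> rcases q with _ | q
    · simp [-mul_eq_mul_left_iff, -mul_eq_mul_right_iff, -mul_eq_zero, -zero_eq_mul] at *
      linear_combination (-(η : ℂ)) * hk
    · have h2 := ih 0 q
      simp [-mul_eq_mul_left_iff, -mul_eq_mul_right_iff, -mul_eq_zero, -zero_eq_mul] at *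
      linear_combination ζ * h2 + (-(η : ℂ)) * hk
    · have h1 := ih p 0
      simp [-mul_eq_mul_left_iff, -mul_eq_mul_right_iff, -mul_eq_zero, -zero_eq_mul] at *
      linear_combination η * h1 + (-(η : ℂ)) * hk
    · have h1 := ih p (q + 1)
      have h2 := ih (p + 1) q
      simp [-mul_eq_mul_left_iff, -mul_eq_mul_right_iff, -mul_eq_zero, -zero_eq_mul] at *
      linear_combination η * h1 + ζ * h2 + (-(η : ℂ)) * hk

/-- Coefficient form of `∂_y Fₙ = n ζ Fₙ₋₁ - γ η Fₙ`. -/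
theorem mul_bargmannCoeff_succ (η ζ : ℝ) (γ : ℂ) (n p q : ℕ) :
    (q + 1) * bargmannCoeff η ζ γ n p (q + 1) =
      n * ζ * bargmannCoeff η ζ γ (n - 1) p q - γ * η * bargmannCoeff η ζ γ n p q := by
  induction n generalizing p q with
  | zero =>
    have hq : (q : ℂ) + 1 ≠ 0 := by exact_mod_cast q.succ_ne_zero
    simp only [bargmannCoeff, Nat.factorial_succ]
    push_cast
    field_simp
    ring
  | succ n ih =>
    rw [bargmannCoeff, bargmannCoeff, Nat.add_sub_cancel]
    simp only [Nat.succ_ne_zero, if_false, Nat.add_sub_cancel]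
    have hk := natCast_mul_bargmannCoeff η ζ γ n p q
    rcases p with _ | p <;> rcases q with _ | q
    · simp [-mul_eq_mul_left_iff, -mul_eq_mul_right_iff, -mul_eq_zero, -zero_eq_mul] at *
      linear_combination (-(ζ : ℂ)) * hk
    · have h2 := ih 0 q
      simp [-mul_eq_mul_left_iff, -mul_eq_mul_right_iff, -mul_eq_zero, -zero_eq_mul] at *
      linear_combination ζ * h2 + (-(ζ : ℂ)) * hk
    · have h1 := ih p 0
      simp [-mul_eq_mul_left_iff, -mul_eq_mul_right_iff, -mul_eq_zero, -zero_eq_mul] at *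
      linear_combination η * h1 + (-(ζ : ℂ)) * hk
    · have h1 := ih p (q + 1)
      have h2 := ih (p + 1) q
      simp [-mul_eq_mul_left_iff, -mul_eq_mul_right_iff, -mul_eq_zero, -zero_eq_mul] at *
      linear_combination η * h1 + ζ * h2 + (-(ζ : ℂ)) * hk

/-- The amplitude `⟨p, q| U |n, γ⟩` for one pair of modes, the probe mode being in the coherent
state of amplitude `γ`. -/
noncomputable def fockAmp (η ζ : ℝ) (γ : ℂ) (n p q : ℕ) : ℂ :=
  Complex.exp (-((‖γ‖ ^ 2 / 2 : ℝ) : ℂ)) *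
    ((Real.sqrt ((p.factorial * q.factorial : ℝ) / n.factorial) : ℝ) : ℂ) *
      bargmannCoeff η ζ γ n p q

theorem fockAmp_eq_zero (η ζ : ℝ) (γ : ℂ) (n p q : ℕ) (h : p + q < n) :
    fockAmp η ζ γ n p q = 0 := by
  rw [fockAmp, bargmannCoeff_eq_zero η ζ γ n p q h, mul_zero]

/-- The factors `1/√l!` of the beam splitter and of the coherent state combine into the `1/l!` of
the exponential series. -/
theorem bsAmpPair_mul_coherentAmp (η ζ : ℝ) (γ : ℂ) (n p q : ℕ) (h : n ≤ p + q) :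
    bsAmpPair η ζ n (p + q - n) p q * coherentAmp γ (p + q - n) = fockAmp η ζ γ n p q := by
  rw [fockAmp, ← coeff_mul_pow_div_factorial η ζ γ n (p + q - n) p q (by omega), bsAmpPair,
    coherentAmp]
  generalize p + q - n = l
  have hl : (0 : ℝ) < l.factorial := by exact_mod_cast l.factorial_pos
  have hs : ((Real.sqrt l.factorial : ℝ) : ℂ) ≠ 0 := by
    exact_mod_cast (Real.sqrt_pos.2 hl).ne'
  have hs2 : (l.factorial : ℂ) = ((Real.sqrt l.factorial : ℝ) : ℂ) ^ 2 := by
    rw [← Complex.ofReal_pow, Real.sq_sqrt hl.le]; simp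
  rw [← div_div (_ : ℝ) (n.factorial : ℝ) (l.factorial : ℝ), Real.sqrt_div (by positivity), hs2]
  push_cast
  field_simp

/-! ### Convergence of the sums over the second output -/

/-- `g` is dominated by the Taylor coefficients of an exponential function. -/
def HasExpBound (g : ℕ → ℂ) : Prop :=
  ∃ C R : ℝ, 0 ≤ C ∧ 1 ≤ R ∧ ∀ q, ‖g q‖ ≤ C * (R ^ q / q.factorial)

theorem HasExpBound.zero : HasExpBound fun _ => 0 := ⟨0, 1, le_rfl, le_rfl, by simp⟩

theorem HasExpBound.const_mul {g : ℕ → ℂ} (hg : HasExpBound g) (c : ℂ) :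
    HasExpBound fun q => c * g q := by
  obtain ⟨C, R, hC, hR, h⟩ := hg
  refine ⟨‖c‖ * C, R, by positivity, hR, fun q => ?_⟩
  rw [norm_mul, mul_assoc]
  gcongr
  exact h q

theorem HasExpBound.add {g h : ℕ → ℂ} (hg : HasExpBound g) (hh : HasExpBound h) :
    HasExpBound fun q => g q + h q := by
  obtain ⟨C, R, hC, hR, hg⟩ := hg
  obtain ⟨C', R', hC', hR', hh⟩ := hh
  refine ⟨C + C', max R R', by positivity, le_max_of_le_left hR, fun q => ?_⟩
  rw [add_mul]
  refine (norm_add_le _ _).trans (add_le_add ((hg q).trans ?_) ((hh q).trans ?_))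
  · gcongr
    exact le_max_left _ _
  · gcongr
    exact le_max_right _ _

theorem HasExpBound.shift {g : ℕ → ℂ} (hg : HasExpBound g) :
    HasExpBound fun q => if q = 0 then 0 else g (q - 1) := by
  obtain ⟨C, R, hC, hR, h⟩ := hg
  -- Doubling `R` absorbs the factor `q + 1 ≤ 2^(q+1)` lost in the factorial.
  refine ⟨C, 2 * R, hC, by linarith, fun q => ?_⟩
  rcases q with _ | q
  · simp [hC]
  · simp only [Nat.succ_ne_zero, if_false, Nat.add_sub_cancel]
    refine (h q).trans ?_
    gcongr 1
    rw [div_le_div_iff₀ (by positivity) (by positivity), Nat.factorial_succ, mul_pow]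
    push_cast
    have h1 : (q : ℝ) + 1 ≤ 2 ^ (q + 1) := by exact_mod_cast (Nat.lt_two_pow_self).le
    have h2 : R ^ q ≤ R ^ (q + 1) := pow_le_pow_right₀ hR q.le_succ
    calc R ^ q * (((q : ℝ) + 1) * q.factorial) = ((q : ℝ) + 1) * R ^ q * q.factorial := by ring
      _ ≤ 2 ^ (q + 1) * R ^ (q + 1) * q.factorial := by gcongr

/-- The weight `q!` cancels one of the two factors `1/q!`, leaving an exponential series. -/
theorem HasExpBound.summable_norm {g h : ℕ → ℂ} (hg : HasExpBound g) (hh : HasExpBound h) :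
    Summable fun q => ‖(q.factorial : ℂ) * g q * h q‖ := by
  obtain ⟨C, R, hC, hR, hg⟩ := hg
  obtain ⟨C', R', hC', hR', hh⟩ := hh
  refine .of_nonneg_of_le (fun _ => norm_nonneg _) (fun q => ?_)
    ((Real.summable_pow_div_factorial (R * R')).mul_left (C * C'))
  rw [norm_mul, norm_mul, Complex.norm_natCast]
  have hq : (0 : ℝ) < q.factorial := by exact_mod_cast q.factorial_pos
  calc (q.factorial : ℝ) * ‖g q‖ * ‖h q‖
      ≤ q.factorial * (C * (R ^ q / q.factorial)) * (C' * (R' ^ q / q.factorial)) := by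
        gcongr
        · exact hg q
        · exact hh q
    _ = C * C' * ((R * R') ^ q / q.factorial) := by
        rw [mul_pow]
        field_simp

theorem hasExpBound_bargmannCoeff (η ζ : ℝ) (γ : ℂ) (n p : ℕ) :
    HasExpBound (bargmannCoeff η ζ γ n p) := by
  induction n generalizing p with
  | zero =>
    refine HasExpBound.const_mul (g := fun q => (-(γ * η)) ^ q / q.factorial) ?_ _
    refine ⟨1, max 1 ‖γ * η‖, zero_le_one, le_max_left _ _, fun q => ?_⟩
    rw [norm_div, norm_pow, norm_neg, Complex.norm_natCast, one_mul]
    gcongr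
    exact le_max_right _ _
  | succ n ih =>
    refine (HasExpBound.const_mul ?_ (η : ℂ)).add ((ih p).shift.const_mul (ζ : ℂ))
    split_ifs
    · exact .zero
    · exact ih _

/-! ### Overlaps and their generating functions -/

/-- The overlap of the Bargmann functions of `|n, α⟩` and `|m, β⟩`, restricted to `p` photons in
the first mode. -/
noncomputable def overlapCoeff (η ζ : ℝ) (α β : ℂ) (n m p : ℕ) : ℂ :=
  ∑' q, (p.factorial : ℂ) *
    (q.factorial * bargmannCoeff η ζ α n p q * bargmannCoeff η ζ β m p q)

theorem hasSum_overlapCoeff (η ζ : ℝ) (α β : ℂ) (n m p : ℕ) :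
    HasSum (fun q => (p.factorial : ℂ) *
      (q.factorial * bargmannCoeff η ζ α n p q * bargmannCoeff η ζ β m p q))
      (overlapCoeff η ζ α β n m p) :=
  ((((hasExpBound_bargmannCoeff η ζ α n p).summable_norm
    (hasExpBound_bargmannCoeff η ζ β m p)).of_norm).mul_left _).hasSum

theorem overlapCoeff_comm (η ζ : ℝ) (α β : ℂ) (n m p : ℕ) :
    overlapCoeff η ζ α β n m p = overlapCoeff η ζ β α m n p := by
  unfold overlapCoeff
  congr 1
  ext q
  ring

/-- One factor `η x + ζ y` of the left function moves to the right one as `η ∂ₓ + ζ ∂_y`; the `x`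
part lowers `p` by one. -/
theorem overlapCoeff_succ (η ζ : ℝ) (α β : ℂ) (n m p : ℕ) :
    overlapCoeff η ζ α β (n + 1) m p =
      η * (if p = 0 then 0 else m * η * overlapCoeff η ζ α β n (m - 1) (p - 1) +
        β * ζ * overlapCoeff η ζ α β n m (p - 1)) +
      ζ * (m * ζ * overlapCoeff η ζ α β n (m - 1) p - β * η * overlapCoeff η ζ α β n m p) := by
  have h1 : HasSum (fun q => if p = 0 then 0 else (p.factorial : ℂ) *
      (q.factorial * bargmannCoeff η ζ α n (p - 1) q * bargmannCoeff η ζ β m p q))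
      (if p = 0 then 0 else m * η * overlapCoeff η ζ α β n (m - 1) (p - 1) +
        β * ζ * overlapCoeff η ζ α β n m (p - 1)) := by
    rcases p with _ | p
    · simp
    · simp only [Nat.succ_ne_zero, if_false, Nat.add_sub_cancel]
      refine (((hasSum_overlapCoeff η ζ α β n (m - 1) p).mul_left (m * η : ℂ)).add
        ((hasSum_overlapCoeff η ζ α β n m p).mul_left (β * ζ))).congr_fun ?_
      intro q
      rw [Nat.factorial_succ]
      push_cast
      linear_combination (p.factorial * q.factorial * bargmannCoeff η ζ α n p q) *
        succ_mul_bargmannCoeff η ζ β m p q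
  have h2 : HasSum (fun q => if q = 0 then 0 else (p.factorial : ℂ) *
      (q.factorial * bargmannCoeff η ζ α n p (q - 1) * bargmannCoeff η ζ β m p q))
      (m * ζ * overlapCoeff η ζ α β n (m - 1) p - β * η * overlapCoeff η ζ α β n m p) := by
    rw [← hasSum_nat_add_iff' 1]
    simp only [Finset.sum_range_one, if_true, sub_zero, Nat.succ_ne_zero, if_false,
      Nat.add_sub_cancel]
    refine (((hasSum_overlapCoeff η ζ α β n (m - 1) p).mul_left (m * ζ : ℂ)).sub
        ((hasSum_overlapCoeff η ζ α β n m p).mul_left (β * η))).congr_fun ?_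
    intro q
    rw [Nat.factorial_succ]
    push_cast
    linear_combination (p.factorial * q.factorial * bargmannCoeff η ζ α n p q) *
      mul_bargmannCoeff_succ η ζ β m p q
  refine (hasSum_overlapCoeff η ζ α β (n + 1) m p).unique ?_
  refine ((h1.mul_left (η : ℂ)).add (h2.mul_left (ζ : ℂ))).congr_fun ?_
  intro q
  rw [bargmannCoeff]
  split_ifs <;> ring

/-- The value is `exp (α β η²)`. Hence the common series factor is nonzero and can be cancelled. -/
theorem overlapCoeff_zero_ne_zero (η ζ : ℝ) (α β : ℂ) : overlapCoeff η ζ α β 0 0 0 ≠ 0 := by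
  have h : HasSum (fun q : ℕ => ((q.factorial : ℂ)⁻¹) • (α * β * η ^ 2) ^ q)
      (Complex.exp (α * β * η ^ 2)) := by
    rw [Complex.exp_eq_exp_ℂ]
    exact NormedSpace.exp_series_hasSum_exp' (𝕂 := ℂ) _
  rw [(hasSum_overlapCoeff η ζ α β 0 0 0).unique (h.congr_fun ?_)]
  · exact Complex.exp_ne_zero _
  · intro q
    have hq : (q.factorial : ℂ) ≠ 0 := by exact_mod_cast q.factorial_ne_zero
    simp only [bargmannCoeff, smul_eq_mul]
    rw [show α * β * (η : ℂ) ^ 2 = (-(α * η)) * (-(β * η)) by ring, mul_pow]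
    simp
    field_simp
    rw [← mul_pow]
    ring

/-- The matrix elements, up to the common factor `overlap 0 0`, of a normally ordered Gaussian
operator between Bargmann monomials. -/
def hermiteOverlap {R : Type*} [CommRing R] (Y u w : R) : ℕ → ℕ → R
  | 0, m => w ^ m
  | n + 1, m => Y * m * hermiteOverlap Y u w n (m - 1) + u * hermiteOverlap Y u w n m

/-- Carries the same recursion between power series, polynomials and numbers. -/
theorem map_hermiteOverlap {R S : Type*} [CommRing R] [CommRing S] (f : R →+* S) (Y u w : R)
    (n m : ℕ) : f (hermiteOverlap Y u w n m) = hermiteOverlap (f Y) (f u) (f w) n m := by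
  induction n generalizing m with
  | zero => simp [hermiteOverlap]
  | succ n ih => simp [hermiteOverlap, ih]

theorem hermiteOverlap_zero_left {R : Type*} [CommRing R] (u w : R) (n m : ℕ) :
    hermiteOverlap 0 u w n m = u ^ n * w ^ m := by
  induction n generalizing m with
  | zero => simp [hermiteOverlap]
  | succ n ih => simp only [hermiteOverlap, ih]; ring

theorem hermiteOverlap_zero_zero {R : Type*} [CommRing R] (Y : R) (n : ℕ) :
    hermiteOverlap Y 0 0 n n = n.factorial * Y ^ n := by
  induction n with
  | zero => simp [hermiteOverlap]
  | succ n ih =>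
    rw [hermiteOverlap, Nat.add_sub_cancel, ih, Nat.factorial_succ]
    push_cast
    ring

open PowerSeries in
theorem mk_overlapCoeff (η ζ : ℝ) (α β : ℂ) (n m : ℕ) :
    PowerSeries.mk (overlapCoeff η ζ α β n m) = PowerSeries.mk (overlapCoeff η ζ α β 0 0) *
      hermiteOverlap (C ((η : ℂ) ^ 2) * X + C ((ζ : ℂ) ^ 2))
        (C β * (C (η * ζ : ℂ) * (X - 1))) (C α * (C (η * ζ : ℂ) * (X - 1))) n m := by
  have hrec : ∀ (α β : ℂ) (n m : ℕ), PowerSeries.mk (overlapCoeff η ζ α β (n + 1) m) =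
      (C ((η : ℂ) ^ 2) * X + C ((ζ : ℂ) ^ 2)) * (m : PowerSeries ℂ) *
        PowerSeries.mk (overlapCoeff η ζ α β n (m - 1)) +
      (C β * (C (η * ζ : ℂ) * (X - 1))) * PowerSeries.mk (overlapCoeff η ζ α β n m) := by
    intro α β n m
    have hexp : ∀ A B : PowerSeries ℂ, (C ((η : ℂ) ^ 2) * X + C ((ζ : ℂ) ^ 2)) *
        (m : PowerSeries ℂ) * A + (C β * (C (η * ζ : ℂ) * (X - 1))) * B =
        C ((η : ℂ) ^ 2 * m) * (X * A) + C ((ζ : ℂ) ^ 2 * m) * A +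
          C (β * (η * ζ)) * (X * B) - C (β * (η * ζ)) * B := by
      intro A B
      simp only [map_mul, map_natCast]
      ring
    ext p
    rw [hexp, coeff_mk, overlapCoeff_succ]
    rcases p with _ | p
    · simp only [map_add, map_sub, coeff_C_mul, coeff_zero_X_mul, coeff_mk, if_true]
      ring
    · simp only [map_add, map_sub, coeff_C_mul, coeff_succ_X_mul, coeff_mk, Nat.succ_ne_zero,
        if_false, Nat.add_sub_cancel]
      ring
  induction n generalizing m with
  | zero =>
    rw [hermiteOverlap]
    induction m with
    | zero => simp
    | succ m ih =>
      -- Swapping the two functions lets the recursion act on `m`; the other index is `0`, so its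
      -- lowering term drops out.
      have hc : ∀ m, overlapCoeff η ζ α β 0 m = overlapCoeff η ζ β α m 0 := fun m =>
        funext fun p => overlapCoeff_comm ..
      rw [hc] at ih ⊢
      rw [hrec, ih, Nat.cast_zero, mul_zero, zero_mul, zero_add, pow_succ']
      ring
  | succ n ih =>
    rw [hrec, ih, ih, hermiteOverlap]
    ring

/-! ### Independence of the Hermite generating functions -/

/-- The span of the functions `γ ↦ γᵏ (γ*)ˡ` with `k ≤ m` and `l ≤ n`. -/
def biPolySpace (n m : ℕ) : Submodule ℂ (ℂ → ℂ) :=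
  Submodule.span ℂ {f | ∃ k l : ℕ, k ≤ m ∧ l ≤ n ∧ f = fun γ => γ ^ k * (star γ) ^ l}

theorem biPolySpace_mono {n m n' m' : ℕ} (hn : n ≤ n') (hm : m ≤ m') :
    biPolySpace n m ≤ biPolySpace n' m' := by
  refine Submodule.span_mono ?_
  rintro f ⟨k, l, hk, hl, rfl⟩
  exact ⟨k, l, hk.trans hm, hl.trans hn, rfl⟩

theorem star_mul_mem_biPolySpace {n m : ℕ} {f : ℂ → ℂ} (hf : f ∈ biPolySpace n m) :
    (fun γ => star γ * f γ) ∈ biPolySpace (n + 1) m := by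
  induction hf using Submodule.span_induction with
  | mem f hf =>
    obtain ⟨k, l, hk, hl, rfl⟩ := hf
    refine Submodule.subset_span ⟨k, l + 1, hk, by omega, ?_⟩
    ext γ
    ring
  | zero =>
    convert (biPolySpace (n + 1) m).zero_mem using 1
    ext γ
    simp
  | add f g _ _ hf hg =>
    convert (biPolySpace (n + 1) m).add_mem hf hg using 1
    ext γ
    simp [mul_add]
  | smul c f _ hf =>
    convert (biPolySpace (n + 1) m).smul_mem c hf using 1
    ext γ
    simp
    ring

theorem hermiteOverlap_mem_biPolySpace (Y v : ℂ) (n m : ℕ) :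
    (fun γ => hermiteOverlap Y (star γ * v) (γ * v) n m) ∈ biPolySpace n m := by
  induction n generalizing m with
  | zero =>
    have h : (fun γ : ℂ => γ ^ m * star γ ^ 0) ∈ biPolySpace 0 m :=
      Submodule.subset_span ⟨m, 0, le_rfl, le_rfl, rfl⟩
    convert (biPolySpace 0 m).smul_mem (v ^ m) h using 1
    ext γ
    simp [hermiteOverlap, mul_pow]
    ring
  | succ n ih =>
    convert (biPolySpace (n + 1) m).add_mem
      ((biPolySpace (n + 1) m).smul_mem (Y * m)
        (biPolySpace_mono n.le_succ (Nat.sub_le m 1) (ih (m - 1))))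
      ((biPolySpace (n + 1) m).smul_mem v (star_mul_mem_biPolySpace (ih m))) using 1
    ext γ
    simp [hermiteOverlap]
    ring

-- With `γ = a + i b` the polynomial vanishes for all real `a`, `b`, hence identically; the linear
-- change of variables is invertible since `v ≠ 0`.
open MvPolynomial in
theorem eq_zero_of_eval_star_self_eq_zero (F : MvPolynomial (Fin 2) ℂ) {v : ℂ} (hv : v ≠ 0)
    (hF : ∀ γ : ℂ, eval ![star γ * v, γ * v] F = 0) : F = 0 := by
  set g : Fin 2 → MvPolynomial (Fin 2) ℂ :=
    ![(X 0 - C Complex.I * X 1) * C v, (X 0 + C Complex.I * X 1) * C v] with hg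
  have heval : ∀ x : Fin 2 → ℂ, eval x (aeval g F) =
      eval ![(x 0 - Complex.I * x 1) * v, (x 0 + Complex.I * x 1) * v] F := by
    intro x
    have hcomp : (eval x).comp (aeval g : _ →ₐ[ℂ] MvPolynomial (Fin 2) ℂ).toRingHom =
        eval ![(x 0 - Complex.I * x 1) * v, (x 0 + Complex.I * x 1) * v] := by
      refine ringHom_ext (fun r => by simp) fun j => ?_
      fin_cases j <;> simp [hg]
    exact DFunLike.congr_fun hcomp F
  have hz : aeval g F = 0 := by
    refine funext_set (fun _ => Set.range ((↑) : ℝ → ℂ))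
      (fun _ => Set.infinite_range_of_injective Complex.ofReal_injective) ?_
    intro x hx
    obtain ⟨a, ha⟩ := hx 0 trivial
    obtain ⟨b, hb⟩ := hx 1 trivial
    rw [heval, map_zero, ← hF (a + Complex.I * b)]
    congr 2
    rw [← ha, ← hb]
    ext j
    fin_cases j <;> simp [sub_eq_add_neg]
  refine MvPolynomial.funext fun x => ?_
  have h := heval ![(x 0 + x 1) / (2 * v), (x 1 - x 0) / (2 * Complex.I * v)]
  rw [hz, map_zero] at h
  rw [map_zero, h]
  congr 2
  ext j
  fin_cases j
  · simp
    field_simp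
    ring
  · simp
    field_simp
    ring

/-- A vanishing sum of `Xⁱ Gᵢ`, in which each `Gᵢ` is zero as soon as its constant coefficient is,
has only zero terms. -/
theorem forall_eq_zero_of_sum_X_pow_mul_eq_zero {R : Type*} [CommRing R] (N : ℕ)
    (G : ℕ → Polynomial R) (hG : ∀ i < N, (G i).coeff 0 = 0 → G i = 0)
    (h : ∑ i ∈ Finset.range N, Polynomial.X ^ i * G i = 0) : ∀ i < N, G i = 0 := by
  intro i
  induction i using Nat.strong_induction_on with
  | _ i ih =>
    intro hi
    refine hG i hi ?_
    have hc := congrArg (fun P => Polynomial.coeff P i) h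
    simp only [Polynomial.finsetSum_coeff, Polynomial.coeff_zero] at hc
    -- In degree `i`, terms with `j < i` vanish by induction and those with `j > i` start too high,
    -- leaving the constant coefficient of `G i`.
    rw [Finset.sum_eq_single i, Polynomial.coeff_X_pow_mul', if_pos le_rfl, Nat.sub_self] at hc
    · exact hc
    · intro j hj hji
      rcases lt_or_gt_of_ne hji with hlt | hgt
      · rw [ih j hlt (hlt.trans hi)]
        simp
      · rw [Polynomial.coeff_X_pow_mul', if_neg (by omega)]
    · intro hi'
      exact absurd (Finset.mem_range.2 hi) hi'

open MvPolynomial in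
theorem eq_zero_of_sum_C_mul_monomials_eq_zero (N : ℕ) (D : ℕ → ℕ → ℂ)
    (h : ∑ a ∈ Finset.range N, ∑ b ∈ Finset.range N,
      (C (D a b) * (X 0 ^ a * X 1 ^ b) : MvPolynomial (Fin 2) ℂ) = 0) :
    ∀ a < N, ∀ b < N, D a b = 0 := by
  intro a ha b hb
  have hm : ∀ a b : ℕ, (C (D a b) * (X 0 ^ a * X 1 ^ b) : MvPolynomial (Fin 2) ℂ) =
      monomial (Finsupp.single 0 a + Finsupp.single 1 b) (D a b) := by
    intro a b
    rw [X_pow_eq_monomial, X_pow_eq_monomial, monomial_mul, C_mul_monomial]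
    simp
  have hc := congrArg (coeff (Finsupp.single 0 a + Finsupp.single 1 b)) h
  simp only [hm, coeff_sum, coeff_monomial, coeff_zero] at hc
  have hi : ∀ a' b' : ℕ, (Finsupp.single (0 : Fin 2) a' + Finsupp.single 1 b' =
      Finsupp.single 0 a + Finsupp.single 1 b) ↔ a' = a ∧ b' = b := by
    intro a' b'
    constructor
    · intro he
      have h0 := DFunLike.congr_fun he 0
      have h1 := DFunLike.congr_fun he 1
      simp at h0 h1
      exact ⟨h0, h1⟩
    · rintro ⟨rfl, rfl⟩
      rfl
  simp only [hi, ite_and] at hc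
  simpa [ha, hb, Finset.sum_ite_eq'] using hc

/-- The Gaussian generating functions `∑ Dᵃᵇⁱ Yⁱ Hᵃᵇ(Y, γ* v, γ v)`, with `Y = η² X + ζ²` and
`v = η ζ (X - 1)`, at the points of a unisolvent set determine the coefficients. -/
theorem coeff_eq_zero_of_sum_hermiteOverlap_eq_zero {N : ℕ} {η ζ : ℝ} (hη : η ≠ 0) (hζ : ζ ≠ 0)
    {Γ : Finset ℂ} (hΓ : Unisolvent N Γ) (D : ℕ → ℕ → ℕ → ℂ)
    (h : ∀ γ ∈ Γ, ∑ i ∈ Finset.range (N + 1), ∑ a ∈ Finset.range (N + 1),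
      ∑ b ∈ Finset.range (N + 1), PowerSeries.C (D i a b) *
        ((PowerSeries.C ((η : ℂ) ^ 2) * PowerSeries.X + PowerSeries.C ((ζ : ℂ) ^ 2)) ^ i *
        hermiteOverlap (PowerSeries.C ((η : ℂ) ^ 2) * PowerSeries.X + PowerSeries.C ((ζ : ℂ) ^ 2))
          (PowerSeries.C (star γ) * (PowerSeries.C (η * ζ : ℂ) * (PowerSeries.X - 1)))
          (PowerSeries.C γ * (PowerSeries.C (η * ζ : ℂ) * (PowerSeries.X - 1))) a b) = 0) :
    ∀ i < N + 1, ∀ a < N + 1, ∀ b < N + 1, D i a b = 0 := by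
  have hηC : (η : ℂ) ≠ 0 := by exact_mod_cast hη
  have hζC : (ζ : ℂ) ≠ 0 := by exact_mod_cast hζ
  -- evaluation of the generating function at a number
  have heval : ∀ γ ∈ Γ, ∀ z : ℂ, ∑ i ∈ Finset.range (N + 1), ∑ a ∈ Finset.range (N + 1),
      ∑ b ∈ Finset.range (N + 1), D i a b * ((η ^ 2 * z + ζ ^ 2) ^ i *
        hermiteOverlap (η ^ 2 * z + ζ ^ 2) (star γ * (η * ζ * (z - 1)))
          (γ * (η * ζ * (z - 1))) a b) = 0 := by
    intro γ hγ z
    -- The series are polynomials, so the identity descends to a ring where evaluation at any `z`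
    -- makes sense.
    have hP : (∑ i ∈ Finset.range (N + 1), ∑ a ∈ Finset.range (N + 1),
      ∑ b ∈ Finset.range (N + 1), Polynomial.C (D i a b) *
        ((Polynomial.C ((η : ℂ) ^ 2) * Polynomial.X + Polynomial.C ((ζ : ℂ) ^ 2)) ^ i *
        hermiteOverlap (Polynomial.C ((η : ℂ) ^ 2) * Polynomial.X + Polynomial.C ((ζ : ℂ) ^ 2))
          (Polynomial.C (star γ) * (Polynomial.C (η * ζ : ℂ) * (Polynomial.X - 1)))
          (Polynomial.C γ * (Polynomial.C (η * ζ : ℂ) * (Polynomial.X - 1))) a b)) = 0 := by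
      apply Polynomial.coe_injective ℂ
      rw [← Polynomial.coeToPowerSeries.ringHom_apply, map_sum, Polynomial.coe_zero, ← h γ hγ]
      simp only [map_sum, map_mul, map_pow, map_add, map_hermiteOverlap, map_sub, map_one,
        Polynomial.coeToPowerSeries.ringHom_apply, Polynomial.coe_C, Polynomial.coe_X]
    have := congrArg (Polynomial.evalRingHom z) hP
    simpa only [map_sum, map_mul, map_pow, map_add, map_hermiteOverlap, map_sub, map_one,
      Polynomial.coe_evalRingHom, Polynomial.eval_C, Polynomial.eval_X, map_zero] using this
  -- all amplitudes
  have hall : ∀ z γ : ℂ, ∑ i ∈ Finset.range (N + 1), ∑ a ∈ Finset.range (N + 1),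
      ∑ b ∈ Finset.range (N + 1), D i a b * ((η ^ 2 * z + ζ ^ 2) ^ i *
        hermiteOverlap (η ^ 2 * z + ζ ^ 2) (star γ * (η * ζ * (z - 1)))
          (γ * (η * ζ * (z - 1))) a b) = 0 := by
    intro z γ
    refine congrFun (hΓ (fun γ => ∑ i ∈ Finset.range (N + 1), ∑ a ∈ Finset.range (N + 1),
      ∑ b ∈ Finset.range (N + 1), D i a b * ((η ^ 2 * z + ζ ^ 2) ^ i *
        hermiteOverlap (η ^ 2 * z + ζ ^ 2) (star γ * (η * ζ * (z - 1)))
          (γ * (η * ζ * (z - 1))) a b)) ?_ fun γ hγ => heval γ hγ z) γ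
    have hsum : ∀ f : ℕ → ℂ → ℂ, (∀ i ∈ Finset.range (N + 1), f i ∈ polySpace N) →
        (fun γ => ∑ i ∈ Finset.range (N + 1), f i γ) ∈ polySpace N := by
      intro f hf
      convert (polySpace N).sum_mem hf using 1
      ext γ
      simp
    refine hsum _ fun i _ => hsum _ fun a ha => hsum _ fun b hb => ?_
    refine (polySpace N).smul_mem (D i a b) ((polySpace N).smul_mem _ ?_)
    -- `polySpace N` unfolds to `biPolySpace N N`.
    exact biPolySpace_mono (Nat.lt_succ_iff.1 (Finset.mem_range.1 ha))
      (Nat.lt_succ_iff.1 (Finset.mem_range.1 hb)) (hermiteOverlap_mem_biPolySpace _ _ a b)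
  open MvPolynomial in
  -- independent variables instead of `γ*` and `γ`
  have hmv : ∀ z : ℂ, z ≠ 1 → (∑ i ∈ Finset.range (N + 1), ∑ a ∈ Finset.range (N + 1),
      ∑ b ∈ Finset.range (N + 1), C (D i a b) * (C (η ^ 2 * z + ζ ^ 2) ^ i *
        hermiteOverlap (C (η ^ 2 * z + ζ ^ 2)) (X 0) (X 1) a b) :
          MvPolynomial (Fin 2) ℂ) = 0 := by
    intro z hz
    have hv : (η * ζ * (z - 1) : ℂ) ≠ 0 :=
      mul_ne_zero (mul_ne_zero hηC hζC) (sub_ne_zero.2 hz)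
    refine eq_zero_of_eval_star_self_eq_zero _ hv fun γ => ?_
    rw [← hall z γ]
    simp [map_hermiteOverlap]
  -- Since `η ≠ 0`, the numbers `η² z + ζ²` with `z ≠ 1` are infinitely many roots over the domain
  -- `ℂ[u, w]`, so `Y` becomes an indeterminate.
  have hpoly : (∑ i ∈ Finset.range (N + 1), Polynomial.X ^ i *
      ∑ a ∈ Finset.range (N + 1), ∑ b ∈ Finset.range (N + 1),
        Polynomial.C (MvPolynomial.C (D i a b)) *
        hermiteOverlap Polynomial.X (Polynomial.C (MvPolynomial.X (0 : Fin 2) : MvPolynomial (Fin 2) ℂ))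
          (Polynomial.C (MvPolynomial.X (1 : Fin 2) : MvPolynomial (Fin 2) ℂ)) a b :
            Polynomial (MvPolynomial (Fin 2) ℂ)) = 0 := by
    refine Polynomial.eq_zero_of_infinite_isRoot _ (Set.Infinite.mono ?_
      (Set.Infinite.image (f := fun z : ℂ => MvPolynomial.C ((η : ℂ) ^ 2 * z + ζ ^ 2)) ?_
        (Set.finite_singleton (1 : ℂ)).infinite_compl))
    · rintro _ ⟨z, hz, rfl⟩
      have := hmv z hz
      rw [Set.mem_ofPred_eq, Polynomial.IsRoot, ← Polynomial.coe_evalRingHom, ← this]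
      simp only [map_sum, map_mul, map_pow, map_hermiteOverlap,
        Polynomial.coe_evalRingHom, Polynomial.eval_C, Polynomial.eval_X, Finset.mul_sum]
      refine Finset.sum_congr rfl fun i _ => Finset.sum_congr rfl fun a _ =>
        Finset.sum_congr rfl fun b _ => ?_
      ring
    · intro z _ z' _ hzz
      have := MvPolynomial.C_injective _ _ hzz
      have h2 : (η : ℂ) ^ 2 * (z - z') = 0 := by linear_combination this
      exact sub_eq_zero.1 ((mul_eq_zero.1 h2).resolve_left (pow_ne_zero _ hηC))
  -- At `Y = 0` only `∑ Dᵢₐᵦ uᵃ wᵇ` remains, and distinct monomials are independent.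
  have hcoeff : ∀ i, (∑ a ∈ Finset.range (N + 1), ∑ b ∈ Finset.range (N + 1),
        Polynomial.C (MvPolynomial.C (D i a b)) *
        hermiteOverlap Polynomial.X (Polynomial.C (MvPolynomial.X (0 : Fin 2) : MvPolynomial (Fin 2) ℂ))
          (Polynomial.C (MvPolynomial.X (1 : Fin 2) : MvPolynomial (Fin 2) ℂ)) a b :
            Polynomial (MvPolynomial (Fin 2) ℂ)).coeff 0 = 0 →
      ∀ a < N + 1, ∀ b < N + 1, D i a b = 0 := by
    intro i hi
    refine eq_zero_of_sum_C_mul_monomials_eq_zero (N + 1) (D i) ?_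
    rw [Polynomial.coeff_zero_eq_eval_zero, ← Polynomial.coe_evalRingHom] at hi
    simpa only [map_sum, map_mul, map_hermiteOverlap, Polynomial.coe_evalRingHom,
      Polynomial.eval_C, Polynomial.eval_X, hermiteOverlap_zero_left] using hi
  intro i hi
  refine hcoeff i ?_
  rw [forall_eq_zero_of_sum_X_pow_mul_eq_zero (N + 1) _ ?_ hpoly i hi, Polynomial.coeff_zero]
  intro j _ hj
  refine Finset.sum_eq_zero fun a ha => Finset.sum_eq_zero fun b hb => ?_
  rw [hcoeff j hj a (Finset.mem_range.1 ha) b (Finset.mem_range.1 hb)]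
  simp

/-! ### Amplitudes traced over the second output -/

theorem star_overlapCoeff (η ζ : ℝ) (α β : ℂ) (n m p : ℕ) :
    star (overlapCoeff η ζ α β n m p) = overlapCoeff η ζ (star α) (star β) n m p := by
  refine (hasSum_overlapCoeff η ζ α β n m p).star.unique
    ((hasSum_overlapCoeff η ζ (star α) (star β) n m p).congr_fun fun q => ?_)
  simp only [star_mul', star_bargmannCoeff]
  simp

theorem star_exp_neg_ofReal (x : ℝ) : star (Complex.exp (-(x : ℂ))) = Complex.exp (-(x : ℂ)) := by
  rw [Complex.star_def, ← Complex.exp_conj, map_neg, Complex.conj_ofReal]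

theorem star_ofReal (x : ℝ) : star (x : ℂ) = x := Complex.conj_ofReal x

/-- The partial trace, over the second output mode, of the matrix element of the output state for
the inputs `|n⟩⟨m|` and the coherent state of amplitude `γ`, at `p` photons in the first output. -/
noncomputable def tracedAmp (η ζ : ℝ) (γ : ℂ) (n m p : ℕ) : ℂ :=
  Complex.exp (-((‖γ‖ ^ 2 / 2 : ℝ) : ℂ)) ^ 2 *
    ((((Real.sqrt n.factorial : ℝ) : ℂ)⁻¹ * ((Real.sqrt m.factorial : ℝ) : ℂ)⁻¹) *
      overlapCoeff η ζ γ (star γ) n m p)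

theorem star_tracedAmp (η ζ : ℝ) (γ : ℂ) (n m p : ℕ) :
    star (tracedAmp η ζ γ n m p) = tracedAmp η ζ γ m n p := by
  rw [tracedAmp, tracedAmp]
  simp only [star_mul', star_pow, star_overlapCoeff, star_star, star_inv₀, star_exp_neg_ofReal,
    star_ofReal]
  rw [overlapCoeff_comm η ζ (star γ)]
  ring

theorem hasSum_tracedAmp (η ζ : ℝ) (γ : ℂ) (n m p : ℕ) :
    HasSum (fun q => fockAmp η ζ γ n p q * star (fockAmp η ζ γ m p q))
      (tracedAmp η ζ γ n m p) := by
  unfold tracedAmp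
  refine (((hasSum_overlapCoeff η ζ γ (star γ) n m p).mul_left _).mul_left _).congr_fun fun q => ?_
  have hs : ∀ n : ℕ, ((Real.sqrt ((p.factorial * q.factorial : ℝ) / n.factorial) : ℝ) : ℂ) =
      ((Real.sqrt (p.factorial * q.factorial : ℝ) : ℝ) : ℂ) *
        ((Real.sqrt n.factorial : ℝ) : ℂ)⁻¹ := by
    intro n
    rw [Real.sqrt_div (by positivity), div_eq_mul_inv]
    push_cast
    rfl
  have hpq : ((Real.sqrt (p.factorial * q.factorial : ℝ) : ℝ) : ℂ) ^ 2 =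
      p.factorial * q.factorial := by
    rw [← Complex.ofReal_pow, Real.sq_sqrt (by positivity)]
    simp
  have hstar : star (fockAmp η ζ γ m p q) = Complex.exp (-((‖γ‖ ^ 2 / 2 : ℝ) : ℂ)) *
      ((Real.sqrt ((p.factorial * q.factorial : ℝ) / m.factorial) : ℝ) : ℂ) *
      bargmannCoeff η ζ (star γ) m p q := by
    rw [fockAmp, star_mul', star_mul', star_bargmannCoeff, star_exp_neg_ofReal,
      star_ofReal]
  rw [hstar, fockAmp, hs, hs]
  linear_combination (Complex.exp (-((‖γ‖ ^ 2 / 2 : ℝ) : ℂ)) ^ 2 *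
    ((Real.sqrt n.factorial : ℝ) : ℂ)⁻¹ * ((Real.sqrt m.factorial : ℝ) : ℂ)⁻¹ *
    bargmannCoeff η ζ γ n p q * bargmannCoeff η ζ (star γ) m p q) * hpq

theorem hasSum_tracedAmp_mul (η ζ : ℝ) (γ : ℂ) (a b i p₀ p₁ : ℕ) :
    HasSum (fun y : ℕ × ℕ => fockAmp η ζ γ a p₀ y.1 * star (fockAmp η ζ γ b p₀ y.1) *
      (fockAmp η ζ 0 i p₁ y.2 * star (fockAmp η ζ 0 i p₁ y.2)))
      (tracedAmp η ζ γ a b p₀ * tracedAmp η ζ 0 i i p₁) := by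
  have h0 := hasSum_tracedAmp η ζ γ a b p₀
  have h1 := hasSum_tracedAmp η ζ 0 i i p₁
  generalize tracedAmp η ζ γ a b p₀ = t₀ at h0 ⊢
  generalize tracedAmp η ζ 0 i i p₁ = t₁ at h1 ⊢
  generalize hf : (fun q => fockAmp η ζ γ a p₀ q * star (fockAmp η ζ γ b p₀ q)) = f at h0
  generalize hg : (fun q => fockAmp η ζ 0 i p₁ q * star (fockAmp η ζ 0 i p₁ q)) = g at h1
  have h := h0.mul h1 (summable_mul_of_summable_norm h0.summable.norm h1.summable.norm)
  rwa [← hf, ← hg] at h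

/-! ### Reduction of the counter statistics to two modes -/

/-- The occupation numbers with `a` photons in mode `0`, `i` photons in mode `1` and vacuum in the
further modes. -/
def occPair {r : ℕ} (a i : ℕ) : Occ r := fun j => if j = 0 then a else if j = 1 then i else 0

@[simp] theorem occPair_zero {r : ℕ} (a i : ℕ) : (occPair a i : Occ r) 0 = a := by simp [occPair]

@[simp] theorem occPair_one {r : ℕ} (a i : ℕ) : (occPair a i : Occ r) 1 = i := by simp [occPair]

theorem occPair_of_two_le {r : ℕ} (a i : ℕ) (j : Fin (r + 2)) (hj : 2 ≤ (j : ℕ)) :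
    (occPair a i : Occ r) j = 0 := by
  rw [occPair, if_neg, if_neg]
  · rintro rfl
    simp at hj
  · rintro rfl
    simp at hj

theorem eq_occPair_iff {r : ℕ} (n : Occ r) :
    n = occPair (n 0) (n 1) ↔ ∀ j : Fin (r + 2), 2 ≤ (j : ℕ) → n j = 0 := by
  constructor
  · intro h j hj
    rw [h, occPair_of_two_le _ _ _ hj]
  · intro h
    ext j
    rw [occPair]
    split_ifs with h0 h1
    · rw [h0]
    · rw [h1]
    · refine h j ?_
      have h0' : (j : ℕ) ≠ 0 := fun h => h0 (Fin.ext h)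
      have h1' : (j : ℕ) ≠ 1 := fun h => h1 (Fin.ext (by simpa using h))
      omega

theorem prod_univ_eq_of_two_le {r : ℕ} {M : Type*} [CommMonoid M] (f : Fin (r + 2) → M)
    (hf : ∀ j : Fin (r + 2), 2 ≤ (j : ℕ) → f j = 1) : ∏ j, f j = f 0 * f 1 := by
  rw [Fin.prod_univ_succ, Fin.prod_univ_succ, Finset.prod_eq_one, mul_one, Fin.succ_zero_eq_one]
  intro j _
  exact hf _ (by simp)

theorem sum_occPair {r : ℕ} (a i : ℕ) : ∑ j, (occPair a i : Occ r) j = a + i := by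
  rw [Fin.sum_univ_succ, Fin.sum_univ_succ, Finset.sum_eq_zero, add_zero, Fin.succ_zero_eq_one,
    occPair_zero, occPair_one]
  intro j _
  exact occPair_of_two_le _ _ _ (by simp)

/-- The amplitude `⟨p, q| U |n, γ e₁⟩`. -/
noncomputable def pathAmp {r : ℕ} (η ζ : ℝ) (γ : ℂ) (n p q : Occ r) : ℂ :=
  ∏ j, fockAmp η ζ (if j = 0 then γ else 0) (n j) (p j) (q j)

theorem bsAmp_mul_probeAmp {r : ℕ} (η ζ : ℝ) (γ : ℂ) (n p q : Occ r) (h : n ≤ p + q) :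
    bsAmp η ζ n (p + q - n) p q * probeAmp γ (p + q - n) = pathAmp η ζ γ n p q := by
  rw [bsAmp, probeAmp, pathAmp, ← Finset.prod_mul_distrib]
  exact Finset.prod_congr rfl fun j _ => bsAmpPair_mul_coherentAmp η ζ _ (n j) (p j) (q j) (h j)

theorem pathAmp_eq_zero {r : ℕ} (η ζ : ℝ) (γ : ℂ) (n p q : Occ r) (h : ¬ n ≤ p + q) :
    pathAmp η ζ γ n p q = 0 := by
  obtain ⟨j, hj⟩ : ∃ j, p j + q j < n j := by
    by_contra! hc
    exact h hc
  exact Finset.prod_eq_zero (Finset.mem_univ j) (fockAmp_eq_zero _ _ _ _ _ _ hj)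

/-- Vacuum on both inputs stays vacuum, which confines the outputs to modes `0` and `1`. -/
theorem fockAmp_zero_zero (η ζ : ℝ) (p q : ℕ) :
    fockAmp η ζ 0 0 p q = if p = 0 ∧ q = 0 then 1 else 0 := by
  rcases p with _ | p <;> rcases q with _ | q <;> simp [fockAmp, bargmannCoeff]

theorem pathAmp_occPair {r : ℕ} (η ζ : ℝ) (γ : ℂ) (a i p₀ p₁ q₀ q₁ : ℕ) :
    pathAmp η ζ γ (occPair a i : Occ r) (occPair p₀ p₁) (occPair q₀ q₁) =
      fockAmp η ζ γ a p₀ q₀ * fockAmp η ζ 0 i p₁ q₁ := by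
  rw [pathAmp, prod_univ_eq_of_two_le]
  · simp
  · intro j hj
    have hj0 : j ≠ 0 := by
      rintro rfl
      simp at hj
    simp [occPair_of_two_le _ _ j hj, hj0, fockAmp_zero_zero]

theorem pathAmp_occPair_eq_zero {r : ℕ} (η ζ : ℝ) (γ : ℂ) (a i : ℕ) (p q : Occ r)
    (h : ¬ (p = occPair (p 0) (p 1) ∧ q = occPair (q 0) (q 1))) :
    pathAmp η ζ γ (occPair a i) p q = 0 := by
  rw [eq_occPair_iff, eq_occPair_iff, ← forall₂_and] at h
  push Not at h
  obtain ⟨j, hj, hpq⟩ := h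
  have hj0 : j ≠ 0 := by
    rintro rfl
    simp at hj
  refine Finset.prod_eq_zero (Finset.mem_univ j) ?_
  rw [if_neg hj0, occPair_of_two_le _ _ _ hj, fockAmp_zero_zero, if_neg]
  exact fun hc => hpq hc.1 hc.2

/-- Outputs outside modes `0` and `1` have amplitude zero and the rest factorise. Counting only the
total yields a convolution over the antidiagonal, i.e. a product of generating functions. -/
theorem hasSum_pathAmp {r : ℕ} (η ζ : ℝ) (γ : ℂ) (a b i k : ℕ) :
    HasSum (fun x : Occ r × Occ r => if ∑ j, x.1 j = k then
      pathAmp η ζ γ (occPair a i) x.1 x.2 * star (pathAmp η ζ γ (occPair b i) x.1 x.2) else 0)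
      (∑ s ∈ Finset.HasAntidiagonal.antidiagonal k, tracedAmp η ζ γ a b s.1 * tracedAmp η ζ 0 i i s.2) := by
  have hs : ∀ s ∈ Finset.HasAntidiagonal.antidiagonal k,
      HasSum (fun x : Occ r × Occ r => if x.1 = occPair s.1 s.2 then
        pathAmp η ζ γ (occPair a i) x.1 x.2 * star (pathAmp η ζ γ (occPair b i) x.1 x.2) else 0)
        (tracedAmp η ζ γ a b s.1 * tracedAmp η ζ 0 i i s.2) := by
    rintro ⟨p₀, p₁⟩ -
    have hinj : Function.Injective
        (fun y : ℕ × ℕ => ((occPair p₀ p₁, occPair y.1 y.2) : Occ r × Occ r)) := by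
      rintro ⟨q₀, q₁⟩ ⟨q₀', q₁'⟩ h
      have h2 := (Prod.ext_iff.1 h).2
      have h0 := congrFun h2 0
      have h1 := congrFun h2 1
      simp at h0 h1
      rw [h0, h1]
    rw [← hinj.hasSum_iff]
    · refine (hasSum_tracedAmp_mul η ζ γ a b i p₀ p₁).congr_fun ?_
      rintro ⟨q₀, q₁⟩
      simp only [Function.comp_apply, if_true, pathAmp_occPair, star_mul']
      ring
    · rintro ⟨p, q⟩ hx
      split_ifs with hp
      · rw [pathAmp_occPair_eq_zero, zero_mul]
        rintro ⟨-, hq⟩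
        refine hx ⟨(q 0, q 1), ?_⟩
        dsimp only at hp ⊢
        rw [← hp, ← hq]
      · rfl
  refine (hasSum_sum hs).congr_fun ?_
  rintro ⟨p, q⟩
  by_cases hp : p = occPair (p 0) (p 1)
  · have hiff : ∀ s : ℕ × ℕ, p = occPair s.1 s.2 ↔ s = (p 0, p 1) := by
      rintro ⟨s₀, s₁⟩
      constructor
      · intro h
        rw [h]
        simp
      · intro h
        obtain ⟨rfl, rfl⟩ := Prod.ext_iff.1 h
        exact hp
    have hsum : ∑ j, p j = p 0 + p 1 := by
      conv_lhs => rw [hp]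
      exact sum_occPair _ _
    simp only [hiff, Finset.sum_ite_eq', Finset.HasAntidiagonal.mem_antidiagonal, hsum]
  · have h0 := fun a => pathAmp_occPair_eq_zero η ζ γ a i p q fun hc => hp hc.1
    simp only [h0, zero_mul, ite_self, Finset.sum_const_zero]

theorem exists_occPair_of_ne_zero {r N : ℕ} {ρ : DensityMatrix (Occ r)} (hρ : IsTwirled ρ)
    (hρN : HasMaxPhotons ρ N) {n m : Occ r} (h : ρ.mat n m ≠ 0) :
    ∃ i < N + 1, ∃ a < N + 1, ∃ b < N + 1, n = occPair a i ∧ m = occPair b i := by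
  obtain ⟨χ, hχ⟩ := hρ
  obtain ⟨h1, h2⟩ := not_imp_comm.1 (hχ n m).2 h
  have hn := (eq_occPair_iff n).2 fun j hj => (h2 j hj).1
  have hm := (eq_occPair_iff m).2 fun j hj => (h2 j hj).2
  have hN := mt (hρN n m) h
  rw [hn, hm, sum_occPair, sum_occPair] at hN
  exact ⟨n 1, by omega, n 0, by omega, m 0, by omega, hn, h1 ▸ hm⟩

theorem outputProb_eq {r N : ℕ} (η ζ : ℝ) (γ : ℂ) {ρ : DensityMatrix (Occ r)} (hρ : IsTwirled ρ)
    (hρN : HasMaxPhotons ρ N) (p q : Occ r) :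
    outputProb η ζ γ ρ p q = (∑ i ∈ Finset.range (N + 1), ∑ a ∈ Finset.range (N + 1),
      ∑ b ∈ Finset.range (N + 1), ρ.mat (occPair a i) (occPair b i) *
        (pathAmp η ζ γ (occPair a i) p q * star (pathAmp η ζ γ (occPair b i) p q))).re := by
  rw [outputProb]
  congr 1
  set g : Occ r × Occ r → ℂ := fun x => ρ.mat x.1 x.2 *
    (pathAmp η ζ γ x.1 p q * star (pathAmp η ζ γ x.2 p q)) with hg
  set φ : ℕ × ℕ × ℕ → Occ r × Occ r := fun t => (occPair t.2.1 t.1, occPair t.2.2 t.1) with hφ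
  set T := Finset.range (N + 1) ×ˢ (Finset.range (N + 1) ×ˢ Finset.range (N + 1)) with hT
  have hφi : Function.Injective φ := by
    rintro ⟨i, a, b⟩ ⟨i', a', b'⟩ h
    have h1 := (Prod.ext_iff.1 h).1
    have h2 := (Prod.ext_iff.1 h).2
    have e1 := congrFun h1 0
    have e2 := congrFun h1 1
    have e3 := congrFun h2 0
    simp [hφ] at e1 e2 e3
    rw [e1, e2, e3]
  calc _ = ∑ x ∈ Finset.Iic (p + q) ×ˢ Finset.Iic (p + q), g x := by
        rw [Finset.sum_product]
        refine Finset.sum_congr rfl fun n hn => Finset.sum_congr rfl fun m hm => ?_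
        rw [bsAmp_mul_probeAmp _ _ _ _ _ _ (Finset.mem_Iic.1 hn),
          bsAmp_mul_probeAmp _ _ _ _ _ _ (Finset.mem_Iic.1 hm)]
        simp only [hg]
        ring
    -- The two finite index sets are compared through their common `finsum`: `pathAmp` vanishes off
    -- the first, `ρ` off the second.
    _ = ∑ᶠ x, g x := by
        refine (finsum_eq_sum_of_support_subset g ?_).symm
        rintro ⟨n, m⟩ hx
        rw [Finset.mem_coe, Finset.mem_product, Finset.mem_Iic, Finset.mem_Iic]
        by_contra hc
        refine hx ?_
        rcases not_and_or.1 hc with hc | hc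
        · simp only [hg, pathAmp_eq_zero _ _ _ _ _ _ hc, zero_mul, mul_zero]
        · simp only [hg, pathAmp_eq_zero _ _ _ _ _ _ hc, star_zero, mul_zero]
    _ = ∑ x ∈ T.map ⟨φ, hφi⟩, g x := by
        refine finsum_eq_sum_of_support_subset g ?_
        rintro ⟨n, m⟩ hx
        obtain ⟨i, hi, a, ha, b, hb, rfl, rfl⟩ :=
          exists_occPair_of_ne_zero hρ hρN (left_ne_zero_of_mul hx)
        rw [Finset.mem_coe, Finset.mem_map]
        exact ⟨(i, a, b), by simp [hT]; omega, rfl⟩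
    _ = _ := by
        rw [Finset.sum_map, hT, Finset.sum_product]
        refine Finset.sum_congr rfl fun i _ => ?_
        rw [Finset.sum_product]
        rfl

theorem counterProb_eq {r N : ℕ} (η ζ : ℝ) (γ : ℂ) {ρ : DensityMatrix (Occ r)} (hρ : IsTwirled ρ)
    (hρN : HasMaxPhotons ρ N) (k : ℕ) :
    counterProb η ζ γ ρ k = (∑ i ∈ Finset.range (N + 1), ∑ a ∈ Finset.range (N + 1),
      ∑ b ∈ Finset.range (N + 1), ρ.mat (occPair a i) (occPair b i) *
        ∑ s ∈ Finset.HasAntidiagonal.antidiagonal k, tracedAmp η ζ γ a b s.1 * tracedAmp η ζ 0 i i s.2).re := by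
  have h := Complex.hasSum_re (hasSum_sum fun i (_ : i ∈ Finset.range (N + 1)) =>
    hasSum_sum fun a (_ : a ∈ Finset.range (N + 1)) =>
    hasSum_sum fun b (_ : b ∈ Finset.range (N + 1)) =>
      (hasSum_pathAmp (r := r) η ζ γ a b i k).mul_left (ρ.mat (occPair a i) (occPair b i)))
  refine (h.congr_fun fun x => ?_).tsum_eq
  split_ifs
  · exact outputProb_eq η ζ γ hρ hρN x.1 x.2
  · simp

/-! ### From statistics to the state -/

/-- Conjugation swaps `a` and `b`, so the sum is real: the real part in `counterProb` loses no
information. -/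
theorem re_eq_self_of_hermitian (N : ℕ) (D Q : ℕ → ℕ → ℕ → ℂ)
    (hD : ∀ i a b, star (D i a b) = D i b a) (hQ : ∀ i a b, star (Q i a b) = Q i b a) :
    (((∑ i ∈ Finset.range N, ∑ a ∈ Finset.range N, ∑ b ∈ Finset.range N,
      D i a b * Q i a b).re : ℝ) : ℂ) =
    ∑ i ∈ Finset.range N, ∑ a ∈ Finset.range N, ∑ b ∈ Finset.range N, D i a b * Q i a b := by
  rw [← Complex.conj_eq_iff_re, ← Complex.star_def]
  simp only [star_sum, star_mul', hD, hQ]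
  exact Finset.sum_congr rfl fun i _ => Finset.sum_comm

theorem mainTheorem7 (r N : ℕ) (η ζ : ℝ) (hη : η ≠ 0) (hζ : ζ ≠ 0) (hηζ : η ^ 2 + ζ ^ 2 = 1)
    (Γ : Finset ℂ) (hΓ : Unisolvent N Γ)
    (ρ σ : DensityMatrix (Occ r))
    (hρ : IsTwirled ρ) (hρN : HasMaxPhotons ρ N)
    (hσ : IsTwirled σ) (hσN : HasMaxPhotons σ N)
    (hstat : ∀ γ ∈ Γ, ∀ k : ℕ, counterProb η ζ γ ρ k = counterProb η ζ γ σ k) :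
    ρ = σ := by
  set D : ℕ → ℕ → ℕ → ℂ := fun i a b =>
    ρ.mat (occPair a i) (occPair b i) - σ.mat (occPair a i) (occPair b i) with hD
  set w : ℕ → ℂ := fun n => ((Real.sqrt n.factorial : ℝ) : ℂ)⁻¹ with hw
  have hw0 : ∀ n, w n ≠ 0 := fun n => inv_ne_zero <| by
    have : (0 : ℝ) < n.factorial := by exact_mod_cast n.factorial_pos
    exact_mod_cast (Real.sqrt_pos.2 this).ne'
  have hDstar : ∀ i a b, star (D i a b) = D i b a := by
    intro i a b
    simp only [hD, star_sub]
    rw [ρ.posSemidef.1.apply, σ.posSemidef.1.apply]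
  have hzero : ∀ γ ∈ Γ, ∀ k, ∑ i ∈ Finset.range (N + 1), ∑ a ∈ Finset.range (N + 1),
      ∑ b ∈ Finset.range (N + 1), D i a b *
        ∑ s ∈ Finset.HasAntidiagonal.antidiagonal k, tracedAmp η ζ γ a b s.1 * tracedAmp η ζ 0 i i s.2 = 0 := by
    intro γ hγ k
    have h := hstat γ hγ k
    rw [counterProb_eq η ζ γ hρ hρN, counterProb_eq η ζ γ hσ hσN, ← sub_eq_zero,
      ← Complex.sub_re] at h
    rw [← re_eq_self_of_hermitian (N + 1) D (fun i a b => ∑ s ∈ Finset.HasAntidiagonal.antidiagonal k,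
      tracedAmp η ζ γ a b s.1 * tracedAmp η ζ 0 i i s.2) hDstar, Complex.ofReal_eq_zero, ← h]
    · simp only [hD, sub_mul, Finset.sum_sub_distrib]
    · intro i a b
      simp only [star_sum, star_mul', star_tracedAmp]
  -- The weights `w` are the `1/√n!` of `tracedAmp`; `i!` comes from the diagonal overlap of mode
  -- `1` with vacuum probe. All are nonzero.
  have hcoeff := coeff_eq_zero_of_sum_hermiteOverlap_eq_zero hη hζ hΓ
    (fun i a b => D i a b * (w a * w b * (w i * w i * i.factorial))) ?_
  · have hDz : ∀ i < N + 1, ∀ a < N + 1, ∀ b < N + 1, D i a b = 0 := by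
      intro i hi a ha b hb
      refine (mul_eq_zero.1 (hcoeff i hi a ha b hb)).resolve_right ?_
      have hf : (i.factorial : ℂ) ≠ 0 := by exact_mod_cast i.factorial_ne_zero
      simp [hw0, hf]
    have hmat : ρ.mat = σ.mat := by
      ext n m
      by_contra hne
      have hor : ρ.mat n m ≠ 0 ∨ σ.mat n m ≠ 0 := by
        by_contra! hc
        exact hne (hc.1.trans hc.2.symm)
      obtain ⟨i, hi, a, ha, b, hb, rfl, rfl⟩ := hor.elim (exists_occPair_of_ne_zero hρ hρN)
        (exists_occPair_of_ne_zero hσ hσN)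
      exact hne (sub_eq_zero.1 (hDz i hi a ha b hb))
    cases ρ
    cases σ
    subst hmat
    rfl
  · intro γ hγ
    have hne : ∀ α β : ℂ, PowerSeries.mk (overlapCoeff η ζ α β 0 0) ≠ 0 := by
      intro α β h
      have := congrArg (PowerSeries.coeff 0) h
      rw [PowerSeries.coeff_mk, map_zero] at this
      exact overlapCoeff_zero_ne_zero η ζ α β this
    have hmk : ∀ γ n m, PowerSeries.mk (tracedAmp η ζ γ n m) =
        PowerSeries.C (Complex.exp (-((‖γ‖ ^ 2 / 2 : ℝ) : ℂ)) ^ 2) *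
          (PowerSeries.C (w n * w m) * PowerSeries.mk (overlapCoeff η ζ γ (star γ) n m)) := by
      intro γ n m
      ext p
      rw [PowerSeries.coeff_C_mul, PowerSeries.coeff_C_mul, PowerSeries.coeff_mk,
        PowerSeries.coeff_mk, tracedAmp]
    have hsum : ∑ i ∈ Finset.range (N + 1), ∑ a ∈ Finset.range (N + 1),
        ∑ b ∈ Finset.range (N + 1), PowerSeries.C (D i a b) *
          (PowerSeries.mk (tracedAmp η ζ γ a b) * PowerSeries.mk (tracedAmp η ζ 0 i i)) = 0 := by
      ext k
      simp only [map_sum, PowerSeries.coeff_C_mul, map_zero]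
      simp only [PowerSeries.coeff_mul, PowerSeries.coeff_mk]
      exact hzero γ hγ k
    have hC : ∀ γ : ℂ, (PowerSeries.C (Complex.exp (-((‖γ‖ ^ 2 / 2 : ℝ) : ℂ)) ^ 2) :
        PowerSeries ℂ) ≠ 0 := by
      intro γ h
      exact pow_ne_zero 2 (Complex.exp_ne_zero _)
        (PowerSeries.C_injective (h.trans (map_zero PowerSeries.C).symm))
    -- The prefactors of both modes do not depend on `i`, `a`, `b`, and power series over `ℂ` form a
    -- domain, so they cancel.
    refine (mul_eq_zero.1 (Eq.trans ?_ hsum)).resolve_left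
      (mul_ne_zero (mul_ne_zero (hC γ) (hne γ (star γ))) (mul_ne_zero (hC 0) (hne 0 (star 0))))
    simp only [Finset.mul_sum]
    refine Finset.sum_congr rfl fun i _ => Finset.sum_congr rfl fun a _ =>
      Finset.sum_congr rfl fun b _ => ?_
    rw [hmk, hmk, mk_overlapCoeff η ζ γ (star γ) a b, mk_overlapCoeff η ζ 0 (star 0) i i]
    rw [star_zero, map_zero, zero_mul, hermiteOverlap_zero_zero]
    simp only [map_mul, map_natCast]
    ring
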